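/- **Setting.** Let $G$ be a locally finite, possibly infinite, simple undirected graph with countably many vertices and no isolated vertex (for instance any connected locally finite graph with at least two vertices), and let $r\ge 1$. For a vertex $v$ let $B_r(v)$ be the subgraph of $G$ induced on the vertices at distance at most $r$ from $v$. A function $\phi$ assigning a real number $\phi(B_r(v))$ to each local ball is *invariant* if $\phi(B_r(u))=\phi(B_r(v))$ whenever there is a graph isomorphism $B_r(u)\to B_r(v)$ taking $u$ to $v$. (A function that is invariant under all graph isomorphisms of balls is in particular invariant.) A *walk algorithm* on $G$ prescribes, given the past of the walk, a probability law for the next vertex, supported on the neighbours of the present vertex. An example is the first-order walk with conductances $c>0$ on the edges, which moves from $u$ to a neighbour $x$ with probability $c(u,x)/\sum_{y\in N(u)}c(u,y)$; $c\equiv1$ is the uniform random walk. The walk is started at $v_0=v$ and *restarts* at $v$ according to one of two rules: either (random) at each time step, independently with a fixed probability $\alpha\in(0,1)$, it jumps to $v$ instead of making a step of the algorithm; or (periodic) each time it has made $k$ steps along edges since the start or the last restart, its next transition is a jump to $v$. Restart jumps are flagged, are counted as transitions, and do not count as traversing an edge. The length $l$ of a walk $v_0\to\cdots\to v_l$ is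 its number of transitions. *Anonymization* records a walk by naming its vertices $1,2,3,\dots$ in order of discovery and listing, for each time, the name of the current vertex and the restart flag. *Anonymization with named neighbours* records in addition, after each step along an edge to a vertex $x$, the names of those neighbours $u$ of $x$ that are already named and for which the edge $\{x,u\}$ has not been recorded yet. The RWNN $X_\theta(G,v)$ with reader $f_\theta$ is the random variable $f_\theta(\mathbf z)\in\mathbb R$, where $\mathbf z$ is the record of the restarting walk of length $l$ from $v$. The reader family $(f_\theta)_\theta$ is *sufficiently powerful* if for every $l$, every real function $g$ of records and every $\epsilon>0$ there is $\theta$ with $|g(\mathbf z)-f_\theta(\mathbf z)|<\epsilon$ for all possible records $\mathbf z$ of walks of length $l$ on $G$. Let $C_V(B_r(v))$ be the expected number of transitions until the restarting walk from $v$ has visited every vertex of $B_r(v)$, and $C_E(B_r(v))$ the expected number until it has traversed every edge of $B_r(v)$ (in at least one direction); both lie in $[0,\infty]$. **Theorem.** Assume that the reader is sufficiently powerful and that the walk restarts either with some probability $\alpha\in(0,1)$ or with some period $k\ge r+1$ (with named neighbours $k\ge r$ is enough). Put $C(v)=C_E(B_r(v))$ if anonymization is used, and $C(v)=C_V(B_r(v))$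 if anonymization with named neighbours is used. 1. For every walk algorithm, every invariant $\phi$, all $\epsilon,\delta>0$ and every length $l$ there is $\theta$ such that, for every vertex $v$ with $l>C(v)/\delta$, $$\mathrm{Prob}\big[\,|\phi(B_r(v))-X_\theta(G,v)|<\epsilon\,\big]>1-\delta .$$ In particular, if $l>C(v)/\delta$ for all $v$, this holds simultaneously for all vertices $v$. 2. For every first-order walk with positive conductances, $C(v)<\infty$ for every $v$. If moreover the vertex degrees of $G$ are bounded and the conductances lie between two positive constants (e.g. the uniform random walk), then $\sup_v C(v)<\infty$, and the RWNN is a universal approximator of vertex-level functions in probability: for every invariant $\phi$ and all $\epsilon,\delta>0$ there are a length $l$ and a parameter $\theta$ such that $\mathrm{Prob}[|\phi(B_r(v))-X_\theta(G,v)|<\epsilon]>1-\delta$ for all vertices $v$ of $G$. -/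

import Mathlib

open MeasureTheory ProbabilityTheory
open scoped ENNReal NNReal

namespace RWNN

/-- One time step of a restarting walk: the vertex occupied, and the flag telling whether the
walk arrived there by a restart (and not along an edge). -/
structure State (V : Type*) where
  pos : V
  restarted : Bool

instance {V : Type*} : MeasurableSpace (State V) := ⊤

instance {V : Type*} : DiscreteMeasurableSpace (State V) := ⟨fun _ => trivial⟩

instance {V : Type*} [Countable V] : Countable (State V) :=
  Function.Injective.countable (f := fun s : State V => (s.pos, s.restarted)) (by
    rintro ⟨a, b⟩ ⟨c, d⟩ h
    simpa using h)

/-! ### Local balls and their invariants -/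

section Balls

variable {V : Type*} (G : SimpleGraph V)

/-- Vertex set of the local ball `B_r(v)`; the ball itself is the induced subgraph on it. -/
def ballSet (r : ℕ) (v : V) : Set V := {x | G.edist v x ≤ (r : ℕ∞)}

/-- `B_r(u) ≃ B_r(v)`, by a graph isomorphism that carries the centre to the centre. -/
def BallIso (r : ℕ) (u v : V) : Prop :=
  ∃ e : G.induce (ballSet G r u) ≃g G.induce (ballSet G r v),
    ∀ x : ballSet G r u, (x : V) = u → ((e x : ballSet G r v) : V) = v

/-- A function of the local balls of `G` (where `φ v` stands for `φ (B_r(v))`) is invariant if it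
takes equal values at isomorphic balls. -/
def InvariantOnBalls (r : ℕ) (φ : V → ℝ) : Prop :=
  ∀ u v, BallIso G r u v → φ u = φ v

end Balls

/-! ### Random walks with restarts -/

/-- A random walk algorithm on `G`: given the whole past `h` of the walk up to time `n`, the law
of the next vertex, which is a neighbour of the present vertex. -/
structure WalkAlgorithm {V : Type*} (G : SimpleGraph V) where
  next : (n : ℕ) → (Finset.Iic n → State V) → PMF V
  adj : ∀ n h x, x ∈ (next n h).support → G.Adj (h ⟨n, Finset.mem_Iic.2 le_rfl⟩).pos x

/-- Restart rules: at each time step independently with probability `α`; or periodically, namely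
each time when `k` steps along edges have been made since the start or the last restart. -/
inductive RestartRule
  | random (α : ℝ≥0) (hα : α ∈ Set.Ioo (0 : ℝ≥0) 1)
  | periodic (k : ℕ)

/-- Law of the restart flag at time `t ≥ 1`. A restart is itself a transition of the walk, so that
under `periodic k` the restarts are the transitions number `k + 1`, `2 (k + 1)`, .... -/
noncomputable def RestartRule.coin : RestartRule → ℕ → PMF Bool
  | .random α hα, _ => PMF.ofFintype (fun b => if b then (α : ℝ≥0∞) else 1 - (α : ℝ≥0∞)) (by
      have h : (α : ℝ≥0∞) ≤ 1 := by exact_mod_cast hα.2.le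
      simpa using add_tsub_cancel_of_le h)
  | .periodic k, t => PMF.pure (decide ((k + 1) ∣ t))

section Walk

variable {V : Type*} {G : SimpleGraph V}

/-- Law of the state at time `n + 1` given the past: toss the restart coin, then either jump to the
starting vertex, or make a step of the walk algorithm along an edge. -/
noncomputable def stepLaw (A : WalkAlgorithm G) (ρ : RestartRule) (n : ℕ)
    (h : Finset.Iic n → State V) : PMF (State V) :=
  (ρ.coin (n + 1)).bind fun b =>
    if b then PMF.pure ⟨(h ⟨0, Finset.mem_Iic.2 (Nat.zero_le n)⟩).pos, true⟩
    else (A.next n h).map fun x => ⟨x, false⟩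

noncomputable def stepKernel [Countable V] (A : WalkAlgorithm G) (ρ : RestartRule) (n : ℕ) :
    Kernel (Finset.Iic n → State V) (State V) :=
  Kernel.ofFunOfCountable fun h => (stepLaw A ρ n h).toMeasure

instance [Countable V] (A : WalkAlgorithm G) (ρ : RestartRule) (n : ℕ) :
    IsMarkovKernel (stepKernel A ρ n) :=
  ⟨fun h => PMF.toMeasure.isProbabilityMeasure (stepLaw A ρ n h)⟩

/-- Law, on the space of infinite trajectories, of the restarting random walk from `v`. -/
noncomputable def walkLaw [Countable V] (A : WalkAlgorithm G) (ρ : RestartRule) (v : V) :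
    Measure (ℕ → State V) :=
  Kernel.traj (X := fun _ => State V) (stepKernel A ρ) 0 fun _ => ⟨v, false⟩

instance [Countable V] (A : WalkAlgorithm G) (ρ : RestartRule) (v : V) :
    IsProbabilityMeasure (walkLaw A ρ v) := by
  unfold walkLaw; infer_instance

/-- The first `l` transitions of the trajectory `ω` are steps along edges of `G` or restarts. -/
def IsWalk (G : SimpleGraph V) (l : ℕ) (ω : ℕ → State V) : Prop :=
  (ω 0).restarted = false ∧ ∀ t < l,
    if (ω (t + 1)).restarted then (ω (t + 1)).pos = (ω 0).pos
    else G.Adj (ω t).pos (ω (t + 1)).pos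

/-! ### Local cover times -/

/-- Time until all vertices of `B_r(v)` have been visited. -/
noncomputable def vertexCover (G : SimpleGraph V) (r : ℕ) (v : V) (ω : ℕ → State V) : ℝ≥0∞ :=
  ⨅ (n : ℕ) (_ : ∀ x ∈ ballSet G r v, ∃ t ≤ n, (ω t).pos = x), (n : ℝ≥0∞)

/-- Time until all edges of `B_r(v)` have been traversed, each in at least one direction.
A restart traverses no edge. -/
noncomputable def edgeCover (G : SimpleGraph V) (r : ℕ) (v : V) (ω : ℕ → State V) : ℝ≥0∞ :=
  ⨅ (n : ℕ) (_ : ∀ x ∈ ballSet G r v, ∀ y ∈ ballSet G r v, G.Adj x y →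
      ∃ t < n, (ω (t + 1)).restarted = false ∧ s((ω t).pos, (ω (t + 1)).pos) = s(x, y)),
    (n : ℝ≥0∞)

/-- The local vertex cover time `C_V(B_r(v))`. -/
noncomputable def localVertexCoverTime [Countable V] (A : WalkAlgorithm G) (ρ : RestartRule)
    (r : ℕ) (v : V) : ℝ≥0∞ :=
  ∫⁻ ω, vertexCover G r v ω ∂(walkLaw A ρ v)

/-- The local edge cover time `C_E(B_r(v))`. -/
noncomputable def localEdgeCoverTime [Countable V] (A : WalkAlgorithm G) (ρ : RestartRule)
    (r : ℕ) (v : V) : ℝ≥0∞ :=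
  ∫⁻ ω, edgeCover G r v ω ∂(walkLaw A ρ v)

/-! ### First-order walks -/

/-- The first-order random walk with conductances `c`: from `u` to its neighbour `x` with
probability proportional to `c(u, x)`. The uniform random walk is the case `c = 1`. -/
noncomputable def firstOrder (G : SimpleGraph V) [G.LocallyFinite] (hG : ∀ u, ∃ x, G.Adj u x)
    (c : Sym2 V → ℝ≥0) (hc : ∀ e ∈ G.edgeSet, 0 < c e) : WalkAlgorithm G := by
  classical
  have h0 : ∀ u, ∑' x, (if G.Adj u x then (c s(u, x) : ℝ≥0∞) else 0) ≠ 0 := by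
    intro u hu
    obtain ⟨x, hx⟩ := hG u
    have h1 := ENNReal.tsum_eq_zero.1 hu x
    simp only [hx, if_true, ENNReal.coe_eq_zero] at h1
    exact (hc s(u, x) hx).ne' h1
  have h1 : ∀ u, ∑' x, (if G.Adj u x then (c s(u, x) : ℝ≥0∞) else 0) ≠ ⊤ := by
    intro u
    rw [tsum_eq_sum (s := G.neighborFinset u) (fun x hx => by
      have hx' : ¬ G.Adj u x := by simpa using hx
      rw [if_neg hx'])]
    refine ENNReal.sum_ne_top.2 fun x _ => ?_
    split_ifs <;> simp
  exact
    { next := fun n h =>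
        PMF.normalize
          (fun x => if G.Adj (h ⟨n, Finset.mem_Iic.2 le_rfl⟩).pos x then
            (c s((h ⟨n, Finset.mem_Iic.2 le_rfl⟩).pos, x) : ℝ≥0∞) else 0) (h0 _) (h1 _)
      adj := fun n h x hx => by
        rw [PMF.mem_support_normalize_iff] at hx
        by_contra hn
        simp [hn] at hx }

end Walk

/-! ### Recording functions -/

/-- Entry of a record for one time step: the name of the vertex, whether it was reached by a
restart, and the names of the recorded neighbours (empty for plain anonymization). -/
structure Token where
  name : ℕ
  restarted : Bool
  neighbors : Finset ℕ

abbrev Record := List Token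

inductive Recording
  | anonymization
  | namedNeighbors

section Recording

variable {V : Type*}

/-- Anonymization names the vertices of a walk `1, 2, 3, ...` in their order of discovery: the name
of a visited vertex `x` is the number of distinct vertices seen up to the first visit of `x`. -/
noncomputable def name (ω : ℕ → State V) (x : V) : ℕ :=
  Set.ncard ((fun t => (ω t).pos) '' Set.Iic (sInf {t | (ω t).pos = x}))

/-- Vertices named at time `t`. -/
noncomputable def named (ω : ℕ → State V) (t : ℕ) : Finset V := by
  classical exact (Finset.range (t + 1)).image fun i => (ω i).pos

/-- Edges recorded up to time `t` by the recording with named neighbours: those walked along, and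
those from a vertex reached by a step along an edge to vertices that are already named. -/
def recordedEdges (G : SimpleGraph V) (ω : ℕ → State V) : ℕ → Set (Sym2 V)
  | 0 => ∅
  | t + 1 =>
    if (ω (t + 1)).restarted then recordedEdges G ω t
    else recordedEdges G ω t ∪ {s((ω t).pos, (ω (t + 1)).pos)} ∪
      {e | ∃ u ∈ named ω (t + 1), G.Adj (ω (t + 1)).pos u ∧ e = s((ω (t + 1)).pos, u)}

/-- Names of the neighbours recorded at time `t`: after a step along an edge, the already named
neighbours of the present vertex to which no edge has been recorded yet. -/
noncomputable def newNeighbors (G : SimpleGraph V) (ω : ℕ → State V) : ℕ → Finset ℕ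
  | 0 => ∅
  | t + 1 => by
    classical exact
      if (ω (t + 1)).restarted then ∅
      else Finset.image (name ω) ((named ω (t + 1)).filter fun u => G.Adj (ω (t + 1)).pos u ∧
        s((ω (t + 1)).pos, u) ∉ recordedEdges G ω t ∪ {s((ω t).pos, (ω (t + 1)).pos)})

/-- The recording function: the record of the walk `v_0 → ⋯ → v_l`. -/
noncomputable def record (G : SimpleGraph V) (q : Recording) (l : ℕ) (ω : ℕ → State V) : Record :=
  (List.range (l + 1)).map fun t =>
    { name := name ω (ω t).pos
      restarted := (ω t).restarted
      neighbors := match q with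
        | .anonymization => ∅
        | .namedNeighbors => newNeighbors G ω t }

/-- All possible records of walks of length `l` on `G`. -/
def recordRange (G : SimpleGraph V) (q : Recording) (l : ℕ) : Set Record :=
  {z | ∃ ω, IsWalk G l ω ∧ record G q l ω = z}

end Recording

/-! ### Random walk neural networks -/

/-- The reader `f` with parameters in `Θ` is a universal approximator of functions on `D`. -/
def UniversalReader {Θ : Type*} (f : Θ → Record → ℝ) (D : Set Record) : Prop :=
  ∀ (g : Record → ℝ) (ε : ℝ), 0 < ε → ∃ θ, ∀ z ∈ D, |g z - f θ z| < ε

/-- Restart rules of the universality theorem: any restart probability `α ∈ (0, 1)`, or any period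
`k ≥ r + 1` (with named neighbours, even `k ≥ r`). -/
def RestartRule.Admissible (q : Recording) (r : ℕ) : RestartRule → Prop
  | .random _ _ => True
  | .periodic k => match q with
    | .anonymization => r + 1 ≤ k
    | .namedNeighbors => r ≤ k

section Network

variable {V : Type*} {G : SimpleGraph V}

/-- The cover time that governs the walk length: `C_E(B_r(v))` for anonymization, `C_V(B_r(v))` for
anonymization with named neighbours. -/
noncomputable def coverTime [Countable V] (q : Recording) (A : WalkAlgorithm G) (ρ : RestartRule)
    (r : ℕ) (v : V) : ℝ≥0∞ :=
  match q with
  | .anonymization => localEdgeCoverTime A ρ r v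
  | .namedNeighbors => localVertexCoverTime A ρ r v

/-- `Prob[|y - X_θ(G, v)| < ε]`, where the output `X_θ(G, v)` of the network is the reader `f θ`
applied to the record of a restarting random walk of length `l` started at `v`. -/
noncomputable def probNear [Countable V] (A : WalkAlgorithm G) (ρ : RestartRule) (q : Recording)
    (l : ℕ) {Θ : Type*} (f : Θ → Record → ℝ) (θ : Θ) (v : V) (y ε : ℝ) : ℝ :=
  (walkLaw A ρ v).real {ω | |y - f θ (record G q l ω)| < ε}

/-- The network is a universal approximator of vertex-level functions in probability. -/
def UniversalApproximator [Countable V] (A : WalkAlgorithm G) (ρ : RestartRule) (q : Recording)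
    {Θ : Type*} (f : Θ → Record → ℝ) (r : ℕ) : Prop :=
  ∀ φ : V → ℝ, InvariantOnBalls G r φ → ∀ ε δ : ℝ, 0 < ε → 0 < δ →
    ∃ (l : ℕ) (θ : Θ), ∀ v, 1 - δ < probNear A ρ q l f θ v (φ v) ε

end Network

end RWNN

/-! Approximation. Names identify visited vertices, and a record shows adjacencies between them. If
the walk has covered the ball, every edge of the ball shows, so two covering walks with the same
record start at centres of isomorphic balls (`ballIso_of_record_eq`). Hence an invariant `φ` is, on
covering walks, a function of the record alone. The reader approximates this function on all records
at once, so one parameter serves every start vertex. By Markov's inequality the walk fails to cover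
by time `l` with probability at most `C(v) / l < δ` (`lt_walkLaw_covered`).

Finite cover times. Cut time into blocks of `k + 1` transitions. Whatever the past, a block may
begin with a restart and then follow a fixed path of at most `k` edges to a given target (a vertex
or an edge of the ball). This has probability at least some `p > 0`, so the number of blocks missing
the target has a geometric tail and the expected hitting time is at most `k + (k + 1) / p`
(`lintegral_hitTime_le`, `lintegral_hitTime_hits_le`). The cover time is at most the sum over the
finitely many targets. Bounded degrees and conductances bound both `p⁻¹` and the number of targets
independently of `v`. -/

namespace RWNN

/-! ### Balls -/

section Ball

variable {V : Type*} {G : SimpleGraph V}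

lemma mem_ballSet_iff {r : ℕ} {v x : V} :
    x ∈ ballSet G r v ↔ ∃ p : G.Walk v x, p.length ≤ r := by
  constructor
  · intro h
    have h' : G.edist v x ≤ (r : ℕ∞) := h
    obtain ⟨p, hp⟩ := SimpleGraph.exists_walk_of_edist_ne_top
      (ne_top_of_le_ne_top (ENat.natCast_ne_top r) h')
    exact ⟨p, by rw [← hp] at h'; exact_mod_cast h'⟩
  · rintro ⟨p, hp⟩
    exact (SimpleGraph.edist_le p).trans (by exact_mod_cast hp)

lemma mem_ballSet_self (r : ℕ) (v : V) : v ∈ ballSet G r v :=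
  mem_ballSet_iff.2 ⟨.nil, Nat.zero_le _⟩

lemma mem_ballSet_zero {v x : V} : x ∈ ballSet G 0 v ↔ x = v := by
  constructor
  · intro h
    obtain ⟨p, hp⟩ := mem_ballSet_iff.1 h
    exact (SimpleGraph.Walk.eq_of_length_eq_zero (Nat.le_zero.1 hp)).symm
  · rintro rfl
    exact mem_ballSet_self 0 x

lemma ballSet_mono {m n : ℕ} (h : m ≤ n) (v : V) : ballSet G m v ⊆ ballSet G n v := by
  intro x hx
  obtain ⟨p, hp⟩ := mem_ballSet_iff.1 hx
  exact mem_ballSet_iff.2 ⟨p, hp.trans h⟩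

lemma mem_ballSet_succ_of_adj {n : ℕ} {v x y : V} (hy : y ∈ ballSet G n v) (h : G.Adj y x) :
    x ∈ ballSet G (n + 1) v := by
  obtain ⟨p, hp⟩ := mem_ballSet_iff.1 hy
  exact mem_ballSet_iff.2 ⟨p.concat h, by simpa using hp⟩

lemma mem_ballSet_succ {n : ℕ} {v x : V} :
    x ∈ ballSet G (n + 1) v ↔ x = v ∨ ∃ y ∈ ballSet G n v, G.Adj y x := by
  constructor
  · intro h
    obtain ⟨p, hp⟩ := mem_ballSet_iff.1 h
    cases p using SimpleGraph.Walk.concatRec with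
    | Hnil => exact Or.inl rfl
    | Hconcat q hq =>
      rw [SimpleGraph.Walk.length_concat] at hp
      exact Or.inr ⟨_, mem_ballSet_iff.2 ⟨q, by omega⟩, hq⟩
  · rintro (rfl | ⟨y, hy, h⟩)
    · exact mem_ballSet_self _ _
    · exact mem_ballSet_succ_of_adj hy h

/-- Correspondence of the vertices of two balls, enumerated along `p` and `p'`. -/
lemma mem_ballSet_of_correspondence {ι : Type*} {p p' : ι → V} {i₀ : ι} {r : ℕ}
    (hp : ∀ s t, p s = p t → p' s = p' t) {R : ι → ι → Prop}
    (hR : ∀ s t, R s t → G.Adj (p' s) (p' t))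
    (hcov : ∀ x ∈ ballSet G r (p i₀), ∃ s, p s = x)
    (hfull : ∀ s t, p s ∈ ballSet G r (p i₀) → p t ∈ ballSet G r (p i₀) →
      G.Adj (p s) (p t) → R s t) :
    ∀ n ≤ r, ∀ s, p s ∈ ballSet G n (p i₀) → p' s ∈ ballSet G n (p' i₀) := by
  intro n
  induction n with
  | zero =>
    intro _ s hs
    rw [mem_ballSet_zero] at hs ⊢
    exact hp _ _ hs
  | succ n ih =>
    intro hn s hs
    rcases mem_ballSet_succ.1 hs with h | ⟨y, hy, h⟩
    · rw [hp _ _ h]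
      exact mem_ballSet_self _ _
    -- The predecessor `y` lies in the ball too, so it is enumerated and its edge to `p s` is among
    -- the pairs in `R`; this carries the edge over to `p'`.
    · obtain ⟨t, rfl⟩ := hcov y (ballSet_mono (by omega) _ hy)
      exact mem_ballSet_succ_of_adj (ih (by omega) t hy)
        (hR _ _ (hfull t s (ballSet_mono (by omega) _ hy) (ballSet_mono hn _ hs) h))

/-- `R` stands for the adjacencies shown by a common record: sound everywhere for both enumerations,
complete only inside the balls. The isomorphism is `p s ↦ p' s`. Paths from the centre are
transported through `R`, so it maps ball to ball, and only then does completeness apply to reflect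
adjacency. -/
lemma ballIso_of_correspondence {ι : Type*} {p p' : ι → V} {i₀ : ι} {r : ℕ}
    (hp : ∀ s t, p s = p t ↔ p' s = p' t) {R : ι → ι → Prop}
    (hR : ∀ s t, R s t → G.Adj (p s) (p t)) (hR' : ∀ s t, R s t → G.Adj (p' s) (p' t))
    (hcov : ∀ x ∈ ballSet G r (p i₀), ∃ s, p s = x)
    (hcov' : ∀ x ∈ ballSet G r (p' i₀), ∃ s, p' s = x)
    (hfull : ∀ s t, p s ∈ ballSet G r (p i₀) → p t ∈ ballSet G r (p i₀) →
      G.Adj (p s) (p t) → R s t)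
    (hfull' : ∀ s t, p' s ∈ ballSet G r (p' i₀) → p' t ∈ ballSet G r (p' i₀) →
      G.Adj (p' s) (p' t) → R s t) :
    BallIso G r (p i₀) (p' i₀) := by
  have h1 := mem_ballSet_of_correspondence (fun s t => (hp s t).1) hR' hcov hfull r le_rfl
  have h2 := mem_ballSet_of_correspondence (fun s t => (hp s t).2) hR hcov' hfull' r le_rfl
  choose f hf using fun x : ballSet G r (p i₀) => hcov x x.2
  choose f' hf' using fun x : ballSet G r (p' i₀) => hcov' x x.2
  refine ⟨⟨⟨fun x => ⟨p' (f x), h1 _ (by rw [hf]; exact x.2)⟩,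
    fun x => ⟨p (f' x), h2 _ (by rw [hf']; exact x.2)⟩, ?_, ?_⟩, ?_⟩, ?_⟩
  · intro x
    apply Subtype.ext
    change p (f' _) = x
    rw [← hf x, hp, hf']
  · intro x
    apply Subtype.ext
    change p' (f _) = x
    rw [← hf' x, ← hp, hf]
  · intro x y
    change G.Adj (p' (f x)) (p' (f y)) ↔ G.Adj (x : V) y
    have hx := hf x
    have hy := hf y
    constructor
    · intro h
      have := hR _ _ (hfull' _ _ (h1 _ (by rw [hx]; exact x.2)) (h1 _ (by rw [hy]; exact y.2)) h)
      rwa [hx, hy] at this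
    · intro h
      rw [← hx, ← hy] at h
      exact hR' _ _ (hfull _ _ (by rw [hx]; exact x.2) (by rw [hy]; exact y.2) h)
  · intro x hx
    change p' (f x) = p' i₀
    rw [← hp, hf, hx]

end Ball

/-! ### Records determine covered balls -/

section Records

variable {V : Type*} {G : SimpleGraph V}

/-- The vertices seen up to the two first visits form nested finite sets; equal cardinality makes
them equal, so the later vertex was already seen at the first visit of the earlier one. A vertex
never visited gets the junk name `1` (`sInf ∅ = 0`), hence the two visit hypotheses. -/
lemma name_injOn {ω : ℕ → State V} {x y : V} (hx : ∃ t, (ω t).pos = x) (hy : ∃ t, (ω t).pos = y)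
    (h : name ω x = name ω y) : x = y := by
  wlog hab : sInf {t | (ω t).pos = x} ≤ sInf {t | (ω t).pos = y} generalizing x y
  · exact (this hy hx h.symm (le_of_not_ge hab)).symm
  have ex : (ω (sInf {t | (ω t).pos = x})).pos = x := Nat.sInf_mem (s := {t | (ω t).pos = x}) hx
  have ey : (ω (sInf {t | (ω t).pos = y})).pos = y := Nat.sInf_mem (s := {t | (ω t).pos = y}) hy
  have heq := Set.eq_of_subset_of_ncard_le
    (Set.image_mono (f := fun t => (ω t).pos) (Set.Iic_subset_Iic.2 hab)) h.ge
    ((Set.finite_Iic _).image _)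
  have hmem : y ∈ (fun t => (ω t).pos) '' Set.Iic (sInf {t | (ω t).pos = x}) := by
    rw [heq]
    exact ⟨_, Set.mem_Iic.2 le_rfl, ey⟩
  obtain ⟨t, ht, hty⟩ := hmem
  have h1 : sInf {t | (ω t).pos = y} ≤ t := Nat.sInf_le hty
  rw [← ex, ← ey, le_antisymm hab (h1.trans ht)]

lemma mem_named {ω : ℕ → State V} {t : ℕ} {x : V} : x ∈ named ω t ↔ ∃ i ≤ t, (ω i).pos = x := by
  classical
  simp [named]

/-- Ensures that no edge at a vertex is recorded before that vertex is discovered. -/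
lemma exists_of_mem_recordedEdges {ω : ℕ → State V} {n : ℕ} {e : Sym2 V}
    (he : e ∈ recordedEdges G ω n) : ∀ x ∈ e, ∃ t ≤ n, (ω t).pos = x := by
  induction n with
  | zero => simp [recordedEdges] at he
  | succ n ih =>
    have hmono : e ∈ recordedEdges G ω n → ∀ x ∈ e, ∃ t ≤ n + 1, (ω t).pos = x := by
      intro h x hx
      obtain ⟨t, ht, h⟩ := ih h x hx
      exact ⟨t, by omega, h⟩
    rw [recordedEdges] at he
    split_ifs at he with hr
    · exact hmono he
    · rcases he with (he | he) | ⟨u, hu, -, rfl⟩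
      · exact hmono he
      · rw [Set.mem_singleton_iff] at he
        subst he
        intro x hx
        rcases Sym2.mem_iff.1 hx with rfl | rfl
        · exact ⟨n, by omega, rfl⟩
        · exact ⟨n + 1, le_rfl, rfl⟩
      · intro x hx
        rcases Sym2.mem_iff.1 hx with rfl | rfl
        · exact ⟨n + 1, le_rfl, rfl⟩
        · exact mem_named.1 hu

/-- Entry of the record at time `t`. -/
noncomputable def token (G : SimpleGraph V) (q : Recording) (ω : ℕ → State V) (t : ℕ) : Token :=
  { name := name ω (ω t).pos
    restarted := (ω t).restarted
    neighbors := match q with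
      | .anonymization => ∅
      | .namedNeighbors => newNeighbors G ω t }

lemma token_eq_of_record_eq {q : Recording} {l : ℕ} {ω ω' : ℕ → State V}
    (h : record G q l ω = record G q l ω') {t : ℕ} (ht : t ≤ l) :
    token G q ω t = token G q ω' t :=
  List.map_inj_left.1 h t (List.mem_range.2 (by omega))

/-- The record tells that the `s`-th vertex was left for, or recorded as a neighbour of, the
`t`-th. -/
def HalfLinked (z : ℕ → Token) (l s t : ℕ) : Prop :=
  ∃ i < l, (z (i + 1)).restarted = false ∧ (z (i + 1)).name = (z t).name ∧
    ((z i).name = (z s).name ∨ (z s).name ∈ (z (i + 1)).neighbors)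

/-- The record tells that the `s`-th and the `t`-th vertex are adjacent. -/
def Linked (z : ℕ → Token) (l s t : ℕ) : Prop := HalfLinked z l s t ∨ HalfLinked z l t s

lemma HalfLinked.congr {z z' : ℕ → Token} {l s t : ℕ} (h : ∀ i ≤ l, z i = z' i) (hs : s ≤ l)
    (ht : t ≤ l) (hz : HalfLinked z l s t) : HalfLinked z' l s t := by
  obtain ⟨i, hi, h1⟩ := hz
  refine ⟨i, hi, ?_⟩
  rwa [← h i hi.le, ← h (i + 1) hi, ← h s hs, ← h t ht]

lemma Linked.congr {z z' : ℕ → Token} {l s t : ℕ} (h : ∀ i ≤ l, z i = z' i) (hs : s ≤ l)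
    (ht : t ≤ l) (hz : Linked z l s t) : Linked z' l s t :=
  hz.imp (HalfLinked.congr h hs ht) (HalfLinked.congr h ht hs)

/-- Soundness of the record for any walk, covering or not: injectivity of names turns the recorded
names back into vertices, and the flag rules out mistaking a jump for an edge. -/
lemma HalfLinked.adj {q : Recording} {l s t : ℕ} {ω : ℕ → State V} (hω : IsWalk G l ω)
    (h : HalfLinked (token G q ω) l s t) : G.Adj (ω s).pos (ω t).pos := by
  obtain ⟨i, hi, hr, ht, hs⟩ := h
  have et : (ω (i + 1)).pos = (ω t).pos := name_injOn ⟨_, rfl⟩ ⟨_, rfl⟩ ht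
  have hr' : (ω (i + 1)).restarted = false := hr
  rw [← et]
  rcases hs with hs | hs
  · have es : (ω i).pos = (ω s).pos := name_injOn ⟨_, rfl⟩ ⟨_, rfl⟩ hs
    have := hω.2 i hi
    simp only [hr', Bool.false_eq_true, if_false] at this
    rwa [← es]
  · cases q with
    | anonymization => simp [token] at hs
    | namedNeighbors =>
      simp only [token, newNeighbors, hr', Bool.false_eq_true, if_false, Finset.mem_image,
        Finset.mem_filter] at hs
      obtain ⟨u, ⟨hu, hadj, -⟩, hname⟩ := hs
      obtain ⟨j, -, hj⟩ := mem_named.1 hu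
      rw [← name_injOn ⟨j, hj⟩ ⟨_, rfl⟩ hname]
      exact hadj.symm

lemma Linked.adj {q : Recording} {l s t : ℕ} {ω : ℕ → State V} (hω : IsWalk G l ω)
    (h : Linked (token G q ω) l s t) : G.Adj (ω s).pos (ω t).pos :=
  h.elim (HalfLinked.adj hω) fun h => (HalfLinked.adj hω h).symm

/-- At its discovery a vertex is linked to all its neighbours discovered before. -/
lemma linked_of_adj {l s t : ℕ} {ω : ℕ → State V} (hω : IsWalk G l ω) (hs : s ≤ l) (ht : t ≤ l)
    (h : G.Adj (ω s).pos (ω t).pos) : Linked (token G .namedNeighbors ω) l s t := by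
  wlog hab : sInf {i | (ω i).pos = (ω s).pos} ≤ sInf {i | (ω i).pos = (ω t).pos} generalizing s t
  · exact (this ht hs h.symm (le_of_not_ge hab)).symm
  have ex := Nat.sInf_mem (s := {i | (ω i).pos = (ω s).pos}) ⟨s, rfl⟩
  have ey := Nat.sInf_mem (s := {i | (ω i).pos = (ω t).pos}) ⟨t, rfl⟩
  have hmin : ∀ j, (ω j).pos = (ω t).pos → sInf {i | (ω i).pos = (ω t).pos} ≤ j :=
    fun j hj => Nat.sInf_le hj
  have hbt := hmin t rfl
  generalize sInf {i | (ω i).pos = (ω s).pos} = a at *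
  generalize sInf {i | (ω i).pos = (ω t).pos} = b at *
  simp only [Set.mem_ofPred_eq] at ex ey
  have hne : a ≠ b := by
    rintro rfl
    rw [← ex, ← ey] at h
    exact G.irrefl h
  obtain ⟨i, rfl⟩ : ∃ i, b = i + 1 := ⟨b - 1, by omega⟩
  have hw := hω.2 i (by omega)
  -- A restart leads to the start vertex, which was discovered at time 0, so no vertex is discovered
  -- by a restart.
  have hr : (ω (i + 1)).restarted = false := by
    by_contra hr
    rw [Bool.not_eq_false] at hr
    rw [if_pos hr, ey] at hw
    have := hmin 0 hw.symm
    omega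
  refine Or.inl ⟨i, by omega, hr, by simp only [token, ey], ?_⟩
  -- The edge just walked is left out of the neighbour list, but then the names at times `i` and `i
  -- + 1` show it. Any other edge to an older vertex is listed, since it cannot have been recorded
  -- before the discovery.
  by_cases hi : (ω i).pos = (ω s).pos
  · exact Or.inl (by simp only [token, hi])
  · right
    simp only [token, newNeighbors, hr, Bool.false_eq_true, if_false]
    simp only [Finset.mem_image, Finset.mem_filter]
    refine ⟨(ω s).pos, ⟨mem_named.2 ⟨a, hab, ex⟩, ?_, ?_⟩, rfl⟩
    · rw [ey]
      exact h.symm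
    · rintro (he | he)
      · obtain ⟨j, hj, hj'⟩ := exists_of_mem_recordedEdges he (ω (i + 1)).pos (by simp)
        have := hmin j (hj'.trans ey)
        omega
      · rw [Set.mem_singleton_iff, Sym2.eq_iff] at he
        rcases he with ⟨h1, -⟩ | ⟨-, h2⟩
        · have := hmin i (h1.symm.trans ey)
          omega
        · exact hi h2.symm

/-- By time `n` the ball `B_r(v)` has been covered, in the sense required by the recording. -/
def Covered (G : SimpleGraph V) (q : Recording) (r : ℕ) (v : V) (n : ℕ) (ω : ℕ → State V) : Prop :=
  match q with
  | .anonymization => ∀ x ∈ ballSet G r v, ∀ y ∈ ballSet G r v, G.Adj x y →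
      ∃ t < n, (ω (t + 1)).restarted = false ∧ s((ω t).pos, (ω (t + 1)).pos) = s(x, y)
  | .namedNeighbors => ∀ x ∈ ballSet G r v, ∃ t ≤ n, (ω t).pos = x

lemma Covered.mono {q : Recording} {r : ℕ} {v : V} {m n : ℕ} {ω : ℕ → State V} (hmn : m ≤ n)
    (h : Covered G q r v m ω) : Covered G q r v n ω := by
  cases q with
  | anonymization =>
    intro x hx y hy hxy
    obtain ⟨t, ht, h⟩ := h x hx y hy hxy
    exact ⟨t, by omega, h⟩
  | namedNeighbors =>
    intro x hx
    obtain ⟨t, ht, h⟩ := h x hx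
    exact ⟨t, by omega, h⟩

/-- Traversing all edges visits all vertices: the centre is occupied at time 0, and any other vertex
of the ball is joined to a predecessor inside the ball. -/
lemma Covered.exists_visit {q : Recording} {r l : ℕ} {ω : ℕ → State V}
    (h : Covered G q r (ω 0).pos l ω) {x : V} (hx : x ∈ ballSet G r (ω 0).pos) :
    ∃ t ≤ l, (ω t).pos = x := by
  cases q with
  | namedNeighbors => exact h x hx
  | anonymization =>
    cases r with
    | zero => exact ⟨0, Nat.zero_le _, (mem_ballSet_zero.1 hx).symm⟩
    | succ r =>
      rcases mem_ballSet_succ.1 hx with rfl | ⟨y, hy, hyx⟩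
      · exact ⟨0, Nat.zero_le _, rfl⟩
      · obtain ⟨t, ht, -, he⟩ := h y (ballSet_mono (Nat.le_succ r) _ hy) x hx hyx
        rcases Sym2.eq_iff.1 he with ⟨-, h2⟩ | ⟨h1, -⟩
        · exact ⟨t + 1, ht, h2⟩
        · exact ⟨t, ht.le, h1⟩

/-- Completeness of the record inside the ball. With named neighbours, visiting both endpoints is
enough; otherwise the edge itself must have been traversed. -/
lemma Covered.linked {q : Recording} {r l s t : ℕ} {ω : ℕ → State V} (hω : IsWalk G l ω)
    (h : Covered G q r (ω 0).pos l ω) (hs : s ≤ l) (ht : t ≤ l)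
    (hs' : (ω s).pos ∈ ballSet G r (ω 0).pos) (ht' : (ω t).pos ∈ ballSet G r (ω 0).pos)
    (hadj : G.Adj (ω s).pos (ω t).pos) : Linked (token G q ω) l s t := by
  cases q with
  | namedNeighbors => exact linked_of_adj hω hs ht hadj
  | anonymization =>
    obtain ⟨i, hi, hr, he⟩ := h _ hs' _ ht' hadj
    rcases Sym2.eq_iff.1 he with ⟨h1, h2⟩ | ⟨h1, h2⟩
    · exact Or.inl ⟨i, hi, hr, by simp only [token, h2], Or.inl (by simp only [token, h1])⟩
    · exact Or.inr ⟨i, hi, hr, by simp only [token, h2], Or.inl (by simp only [token, h1])⟩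

/-- The record of a walk that covers the ball around its starting point determines that ball. -/
theorem ballIso_of_record_eq {q : Recording} {r l : ℕ} {ω ω' : ℕ → State V}
    (hω : IsWalk G l ω) (hω' : IsWalk G l ω') (hc : Covered G q r (ω 0).pos l ω)
    (hc' : Covered G q r (ω' 0).pos l ω') (h : record G q l ω = record G q l ω') :
    BallIso G r (ω 0).pos (ω' 0).pos := by
  have htok : ∀ i ≤ l, token G q ω i = token G q ω' i := fun i hi => token_eq_of_record_eq h hi
  have hname : ∀ i ≤ l, name ω (ω i).pos = name ω' (ω' i).pos :=
    fun i hi => congrArg Token.name (htok i hi)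
  refine ballIso_of_correspondence (ι := Set.Iic l) (p := fun i => (ω i).pos)
    (p' := fun i => (ω' i).pos) (i₀ := ⟨0, Nat.zero_le l⟩)
    (R := fun s t => Linked (token G q ω) l s t) ?_ ?_ ?_ ?_ ?_ ?_ ?_
  · rintro ⟨s, hs⟩ ⟨t, ht⟩
    constructor
    · intro e
      refine name_injOn ⟨_, rfl⟩ ⟨_, rfl⟩ ?_
      change (ω s).pos = (ω t).pos at e
      rw [← hname s hs, ← hname t ht, e]
    · intro e
      refine name_injOn ⟨_, rfl⟩ ⟨_, rfl⟩ ?_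
      change (ω' s).pos = (ω' t).pos at e
      rw [hname s hs, hname t ht, e]
  · exact fun s t hst => hst.adj hω
  · exact fun s t hst => (hst.congr htok s.2 t.2).adj hω'
  · intro x hx
    obtain ⟨t, ht, hx⟩ := hc.exists_visit hx
    exact ⟨⟨t, ht⟩, hx⟩
  · intro x hx
    obtain ⟨t, ht, hx⟩ := hc'.exists_visit hx
    exact ⟨⟨t, ht⟩, hx⟩
  · exact fun s t hs ht hst => hc.linked hω s.2 t.2 hs ht hst
  · exact fun s t hs ht hst =>
      (hc'.linked hω' s.2 t.2 hs ht hst).congr (fun i hi => (htok i hi).symm) s.2 t.2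

end Records


/-! ### The law of a restarting walk -/

section Law

variable {V : Type*} {G : SimpleGraph V}

/-- The event `B` depends on the trajectory up to time `n` only. -/
def IsPast (n : ℕ) (B : Set (ℕ → State V)) : Prop :=
  ∀ ω ω', (∀ i ≤ n, ω i = ω' i) → ω ∈ B → ω' ∈ B

lemma IsPast.compl {n : ℕ} {B : Set (ℕ → State V)} (h : IsPast n B) : IsPast n Bᶜ :=
  fun ω ω' e hω hω' => hω (h ω' ω (fun i hi => (e i hi).symm) hω')

/-- Reduces past events to sets of finite histories, which form a countable space; this gives
measurability and access to the one-step law. -/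
lemma IsPast.eq_preimage {n : ℕ} {B : Set (ℕ → State V)} (h : IsPast n B) :
    B = Preorder.frestrictLe n ⁻¹' (Preorder.frestrictLe (π := fun _ => State V) n '' B) := by
  refine Set.Subset.antisymm (Set.subset_preimage_image _ _) ?_
  rintro ω ⟨ω', hω', e⟩
  exact h ω' ω (fun i hi => congrFun e ⟨i, Finset.mem_Iic.2 hi⟩) hω'

lemma coin_le_stepLaw_restart (A : WalkAlgorithm G) (ρ : RestartRule) (n : ℕ) (h : Finset.Iic n → State V) :
    ρ.coin (n + 1) true ≤
      stepLaw A ρ n h ⟨(h ⟨0, Finset.mem_Iic.2 (Nat.zero_le n)⟩).pos, true⟩ := by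
  rw [stepLaw, PMF.bind_apply]
  refine le_trans ?_ (ENNReal.le_tsum true)
  simp

lemma coin_mul_next_le_stepLaw (A : WalkAlgorithm G) (ρ : RestartRule) (n : ℕ) (h : Finset.Iic n → State V) (x : V) :
    ρ.coin (n + 1) false * A.next n h x ≤ stepLaw A ρ n h ⟨x, false⟩ := by
  rw [stepLaw, PMF.bind_apply]
  refine le_trans ?_ (ENNReal.le_tsum false)
  gcongr
  rw [if_neg (by simp), PMF.map_apply]
  refine le_trans ?_ (ENNReal.le_tsum x)
  simp

variable [Countable V]

lemma IsPast.measurableSet {n : ℕ} {B : Set (ℕ → State V)} (h : IsPast n B) :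
    MeasurableSet B := by
  rw [h.eq_preimage]
  exact Preorder.measurable_frestrictLe n (Set.to_countable _).measurableSet

variable (A : WalkAlgorithm G) (ρ : RestartRule) (v : V)

/-- The joint law of the past and the next state is the composition product given by the
Ionescu-Tulcea construction. The set `S` may depend on the history, which is needed for the support
statement below. -/
lemma walkLaw_succ (n : ℕ) (S : (Finset.Iic n → State V) → Set (State V))
    (B : Set (Finset.Iic n → State V)) :
    walkLaw A ρ v {ω | Preorder.frestrictLe n ω ∈ B ∧ ω (n + 1) ∈ S (Preorder.frestrictLe n ω)} =
      ∫⁻ ω in Preorder.frestrictLe n ⁻¹' B,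
        (stepLaw A ρ n (Preorder.frestrictLe n ω)).toMeasure (S (Preorder.frestrictLe n ω))
        ∂(walkLaw A ρ v) := by
  have key := Kernel.partialTraj_compProd_eq_map_traj (X := fun _ => State V)
    (κ := stepKernel A ρ) (Nat.zero_le n) (x₀ := fun _ => ⟨v, false⟩)
  have hmeas : MeasurableSet {z : (Finset.Iic n → State V) × State V | z.1 ∈ B ∧ z.2 ∈ S z.1} :=
    (Set.to_countable _).measurableSet
  have h := congrArg (fun m => m {z : (Finset.Iic n → State V) × State V | z.1 ∈ B ∧ z.2 ∈ S z.1})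
    key
  beta_reduce at h
  rw [Measure.map_apply (by fun_prop) hmeas, Measure.compProd_apply hmeas,
    ← Kernel.traj_map_frestrictLe_apply, lintegral_map (measurable_of_countable _)
      (Preorder.measurable_frestrictLe n)] at h
  have hB : MeasurableSet B := (Set.to_countable _).measurableSet
  rw [← lintegral_indicator (Preorder.measurable_frestrictLe n hB)]
  refine (Eq.trans ?_ h.symm).trans ?_
  · rfl
  · refine lintegral_congr fun ω => ?_
    by_cases hω : Preorder.frestrictLe n ω ∈ B
    · rw [Set.indicator_of_mem (show ω ∈ Preorder.frestrictLe n ⁻¹' B from hω)]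
      change (stepLaw A ρ n (Preorder.frestrictLe n ω)).toMeasure _ = _
      congr 1
      ext s
      exact and_iff_right hω
    · rw [Set.indicator_of_notMem (show ω ∉ Preorder.frestrictLe n ⁻¹' B from hω)]
      have : Prod.mk (Preorder.frestrictLe n ω) ⁻¹'
          {z : (Finset.Iic n → State V) × State V | z.1 ∈ B ∧ z.2 ∈ S z.1} = ∅ := by
        ext s
        simp only [Set.mem_preimage, Set.mem_ofPred_eq, Set.mem_empty_iff_false, iff_false, not_and]
        exact fun h => absurd h hω
      rw [this, measure_empty]

lemma walkLaw_ae_zero : ∀ᵐ ω ∂(walkLaw A ρ v), ω 0 = ⟨v, false⟩ := by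
  have h := Kernel.traj_map_frestrictLe_apply (X := fun _ => State V)
    (κ := stepKernel A ρ) 0 0 (fun _ => ⟨v, false⟩)
  rw [Kernel.partialTraj_self, Kernel.id_apply] at h
  have h2 : ∀ᵐ x ∂(Measure.map (Preorder.frestrictLe 0) (walkLaw A ρ v)),
      x = fun _ : Finset.Iic 0 => (⟨v, false⟩ : State V) := by
    unfold walkLaw
    rw [h, ae_dirac_iff (Set.to_countable _).measurableSet]
  filter_upwards [ae_of_ae_map (Preorder.measurable_frestrictLe 0).aemeasurable h2] with ω hω
  exact congrFun hω ⟨0, Finset.mem_Iic.2 le_rfl⟩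

lemma walkLaw_ae_succ (n : ℕ) : ∀ᵐ ω : ℕ → State V ∂(walkLaw A ρ v),
    ω (n + 1) ∈ (stepLaw A ρ n (Preorder.frestrictLe n ω)).support := by
  have h := walkLaw_succ A ρ v n (fun h => (stepLaw A ρ n h).supportᶜ) Set.univ
  have h0 : ∀ ω : ℕ → State V, (stepLaw A ρ n (Preorder.frestrictLe n ω)).toMeasure
      (stepLaw A ρ n (Preorder.frestrictLe n ω)).supportᶜ = 0 := fun ω =>
    (PMF.toMeasure_apply_eq_zero_iff _ (Set.to_countable _).measurableSet).2 disjoint_compl_right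
  simp only [h0, lintegral_zero, Set.mem_univ, true_and] at h
  exact h

lemma walkLaw_ae_isWalk (l : ℕ) : ∀ᵐ ω : ℕ → State V ∂(walkLaw A ρ v), (ω 0).pos = v ∧ IsWalk G l ω := by
  filter_upwards [walkLaw_ae_zero A ρ v, ae_all_iff.2 (walkLaw_ae_succ A ρ v)] with ω h0 h
  refine ⟨by rw [h0], by rw [h0], fun t _ => ?_⟩
  have ht := h t
  rw [stepLaw, PMF.mem_support_bind_iff] at ht
  obtain ⟨b, -, hb⟩ := ht
  cases b with
  | true =>
    rw [if_pos rfl, PMF.mem_support_pure_iff] at hb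
    rw [hb, if_pos rfl]
    rfl
  | false =>
    rw [if_neg (by simp), PMF.mem_support_map_iff] at hb
    obtain ⟨x, hx, hb⟩ := hb
    rw [← hb, if_neg (by simp)]
    exact A.adj t _ x hx

variable {A ρ v}

/-- The bound on the transition probability is needed only for trajectories starting at `v`, as
almost all do; a restart jumps to the trajectory's own initial position. -/
lemma le_walkLaw_inter_succ {n : ℕ} {B : Set (ℕ → State V)} (hB : IsPast n B) {p : ℝ≥0∞}
    {s : State V}
    (hp : ∀ ω ∈ B, (ω 0).pos = v → p ≤ stepLaw A ρ n (Preorder.frestrictLe n ω) s) :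
    p * walkLaw A ρ v B ≤ walkLaw A ρ v (B ∩ {ω | ω (n + 1) = s}) := by
  have h := walkLaw_succ A ρ v n (fun _ => {s}) (Preorder.frestrictLe n '' B)
  have e : {ω : ℕ → State V | Preorder.frestrictLe n ω ∈ Preorder.frestrictLe n '' B ∧
      ω (n + 1) ∈ ({s} : Set (State V))} = B ∩ {ω | ω (n + 1) = s} := by
    conv_rhs => rw [hB.eq_preimage]
    rfl
  rw [e, ← hB.eq_preimage] at h
  rw [h, ← setLIntegral_const]
  refine setLIntegral_mono_ae' hB.measurableSet ?_
  filter_upwards [walkLaw_ae_zero A ρ v] with ω h0 hω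
  rw [PMF.toMeasure_apply_singleton _ _ (Set.to_countable _).measurableSet]
  exact hp ω hω (by rw [h0])

/-- Lower bound for the probability that the walk follows a prescribed sequence of states. -/
lemma pow_mul_le_walkLaw_inter {n : ℕ} {B : Set (ℕ → State V)} (hB : IsPast n B) {p : ℝ≥0∞}
    (σ : ℕ → State V) (m : ℕ)
    (hp : ∀ i < m, ∀ ω : ℕ → State V, (ω 0).pos = v → (∀ j < i, ω (n + 1 + j) = σ j) →
      p ≤ stepLaw A ρ (n + i) (Preorder.frestrictLe (n + i) ω) (σ i)) :
    p ^ m * walkLaw A ρ v B ≤ walkLaw A ρ v (B ∩ {ω | ∀ j < m, ω (n + 1 + j) = σ j}) := by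
  induction m with
  | zero => simp
  | succ m ih =>
    have hpast : IsPast (n + m) (B ∩ {ω | ∀ j < m, ω (n + 1 + j) = σ j}) := by
      rintro ω ω' e ⟨hω, hj⟩
      exact ⟨hB ω ω' (fun i hi => e i (by omega)) hω,
        fun j hjm => (e _ (by omega)).symm.trans (hj j hjm)⟩
    calc p ^ (m + 1) * walkLaw A ρ v B = p * (p ^ m * walkLaw A ρ v B) := by ring
      _ ≤ p * walkLaw A ρ v (B ∩ {ω | ∀ j < m, ω (n + 1 + j) = σ j}) := by
        gcongr
        exact ih fun i hi => hp i (by omega)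
      _ ≤ walkLaw A ρ v (B ∩ {ω | ∀ j < m, ω (n + 1 + j) = σ j} ∩ {ω | ω (n + m + 1) = σ m}) :=
        le_walkLaw_inter_succ hpast fun ω hω h0 => hp m (by omega) ω h0 hω.2
      _ ≤ _ := by
        refine measure_mono ?_
        rintro ω ⟨⟨hω, hj⟩, hm⟩
        refine ⟨hω, fun j hjm => ?_⟩
        rcases Nat.lt_succ_iff_lt_or_eq.1 hjm with h | rfl
        · exact hj j h
        · rw [← hm]
          congr 1
          omega

end Law

/-! ### Expected hitting times -/

section Hitting

variable {Ω : Type*}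

/-- The first time at which an increasing sequence of events occurs. -/
noncomputable def hitTime (P : ℕ → Set Ω) (ω : Ω) : ℝ≥0∞ := ⨅ (n : ℕ) (_ : ω ∈ P n), (n : ℝ≥0∞)

lemma hitTime_le {P : ℕ → Set Ω} {ω : Ω} {n : ℕ} (h : ω ∈ P n) : hitTime P ω ≤ n :=
  iInf₂_le n h

lemma exists_of_hitTime_lt {P : ℕ → Set Ω} {ω : Ω} {a : ℝ≥0∞} (h : hitTime P ω < a) :
    ∃ n : ℕ, (n : ℝ≥0∞) < a ∧ ω ∈ P n := by
  obtain ⟨n, h⟩ := iInf_lt_iff.1 h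
  obtain ⟨hn, h⟩ := iInf_lt_iff.1 h
  exact ⟨n, h, hn⟩

lemma exists_hitTime_eq {P : ℕ → Set Ω} {ω : Ω} (h : hitTime P ω ≠ ⊤) :
    ∃ n : ℕ, hitTime P ω = n ∧ ω ∈ P n := by
  classical
  have hex : ∃ n, ω ∈ P n := by
    obtain ⟨n, -, hn⟩ := exists_of_hitTime_lt (lt_top_iff_ne_top.2 h)
    exact ⟨n, hn⟩
  refine ⟨Nat.find hex, le_antisymm (hitTime_le (Nat.find_spec hex)) ?_, Nat.find_spec hex⟩
  exact le_iInf₂ fun n hn => by exact_mod_cast Nat.find_min' hex hn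

/-- For monotone events the joint hitting time is the largest of the individual ones; the sum is a
cruder bound whose expectation is immediate. -/
lemma hitTime_forall_le_sum {ι : Type*} (F : Finset ι) (P : ι → ℕ → Set Ω)
    (hmono : ∀ i, Monotone (P i)) (ω : Ω) :
    hitTime (fun n => {ω | ∀ i ∈ F, ω ∈ P i n}) ω ≤ ∑ i ∈ F, hitTime (P i) ω := by
  by_cases htop : ∃ i ∈ F, hitTime (P i) ω = ⊤
  · rw [ENNReal.sum_eq_top.2 htop]
    exact le_top
  push Not at htop
  choose! n hn hn' using fun i hi => exists_hitTime_eq (htop i hi)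
  rw [Finset.sum_congr rfl hn, ← Nat.cast_sum]
  exact hitTime_le fun i hi =>
    hmono i (Finset.single_le_sum (f := n) (fun _ _ => Nat.zero_le _) hi) (hn' i hi)

variable [MeasurableSpace Ω]

lemma measurable_hitTime {P : ℕ → Set Ω} (hP : ∀ n, MeasurableSet (P n)) :
    Measurable (hitTime P) := by
  classical
  refine Measurable.iInf fun n => ?_
  have : (fun ω => ⨅ (_ : ω ∈ P n), (n : ℝ≥0∞)) = fun ω => if ω ∈ P n then (n : ℝ≥0∞) else ⊤ := by
    ext ω
    split_ifs with h <;> simp [h]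
  rw [this]
  exact Measurable.ite (hP n) measurable_const measurable_const

/-- If, in each block of `k + 1` time steps, an event which has not occurred yet occurs with
conditional probability at least `p`, then its expected time is at most `k + (k + 1) / p`. -/
lemma lintegral_hitTime_le {μ : Measure Ω} [IsProbabilityMeasure μ] {P : ℕ → Set Ω}
    (hmeas : ∀ n, MeasurableSet (P n)) (k : ℕ) {p : ℝ≥0∞} (hp : p ≤ 1)
    (h : ∀ j, p * μ (P ((k + 1) * j + k))ᶜ ≤
      μ ((P ((k + 1) * j + k))ᶜ ∩ P ((k + 1) * (j + 1) + k))) (hmono : Monotone P) :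
    ∫⁻ ω, hitTime P ω ∂μ ≤ k + (k + 1) * p⁻¹ := by
  classical
  -- Checkpoints just before the multiples of `k + 1`, so that under period `k` the next transition
  -- is a restart.
  set N : ℕ → ℕ := fun j => (k + 1) * j + k with hN
  have hNmono : Monotone N := fun i j hij => by
    simp only [hN]
    gcongr
  have hgeom : ∀ j, μ (P (N j))ᶜ ≤ (1 - p) ^ j := by
    intro j
    induction j with
    | zero => simpa using prob_le_one
    | succ j ih =>
      have hsplit : μ (P (N (j + 1)))ᶜ + p * μ (P (N j))ᶜ ≤ μ (P (N j))ᶜ := by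
        calc μ (P (N (j + 1)))ᶜ + p * μ (P (N j))ᶜ
            ≤ μ (P (N (j + 1)))ᶜ + μ ((P (N j))ᶜ ∩ P (N (j + 1))) := by
              gcongr
              exact h j
          _ = μ ((P (N j))ᶜ ∩ P (N (j + 1))) + μ ((P (N j))ᶜ \ P (N (j + 1))) := by
              rw [add_comm]
              congr 2
              ext ω
              simp only [Set.mem_compl_iff, Set.mem_sdiff]
              exact ⟨fun h => ⟨fun h' => h (hmono (hNmono (Nat.le_succ j)) h'), h⟩, fun h => h.2⟩
          _ = μ (P (N j))ᶜ := measure_inter_add_sdiff _ (hmeas _)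
      have hfin : p * μ (P (N j))ᶜ ≠ ⊤ :=
        ENNReal.mul_ne_top (ne_top_of_le_ne_top ENNReal.one_ne_top hp) (measure_ne_top _ _)
      calc μ (P (N (j + 1)))ᶜ ≤ μ (P (N j))ᶜ - p * μ (P (N j))ᶜ :=
            ENNReal.le_sub_of_add_le_right hfin hsplit
        _ = (1 - p) * μ (P (N j))ᶜ := by
            rw [ENNReal.sub_mul (fun _ _ => measure_ne_top _ _), one_mul]
        _ ≤ (1 - p) * (1 - p) ^ j := by gcongr
        _ = (1 - p) ^ (j + 1) := (pow_succ' _ _).symm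
  -- The series counts the missed checkpoints. If the first success is at checkpoint `j`, it is at
  -- least `j`, and the hitting time is at most `N j = k + (k + 1) * j`.
  have hpt : ∀ ω, hitTime P ω ≤
      k + (k + 1) * ∑' j, (P (N j))ᶜ.indicator (fun _ => (1 : ℝ≥0∞)) ω := by
    intro ω
    by_cases hex : ∃ j, ω ∈ P (N j)
    · have hsum : (Nat.find hex : ℝ≥0∞) ≤
          ∑' j, (P (N j))ᶜ.indicator (fun _ => (1 : ℝ≥0∞)) ω := by
        refine le_trans ?_ (ENNReal.sum_le_tsum (Finset.range (Nat.find hex)))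
        rw [Finset.sum_congr rfl fun j hj => Set.indicator_of_mem
          (show ω ∈ (P (N j))ᶜ from Nat.find_min hex (Finset.mem_range.1 hj)) _]
        simp
      refine (hitTime_le (Nat.find_spec hex)).trans ?_
      calc ((N (Nat.find hex) : ℕ) : ℝ≥0∞) = k + (k + 1) * (Nat.find hex : ℝ≥0∞) := by
            simp only [hN]
            push_cast
            ring
        _ ≤ _ := by gcongr
    · push Not at hex
      have : ∑' j, (P (N j))ᶜ.indicator (fun _ => (1 : ℝ≥0∞)) ω = ⊤ := by
        rw [tsum_congr fun j => Set.indicator_of_mem (show ω ∈ (P (N j))ᶜ from hex j) _]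
        exact ENNReal.tsum_const_eq_top_of_ne_zero one_ne_zero
      rw [this, ENNReal.mul_top (by positivity), add_top]
      exact le_top
  calc ∫⁻ ω, hitTime P ω ∂μ
      ≤ ∫⁻ ω, (k + (k + 1) * ∑' j, (P (N j))ᶜ.indicator (fun _ => (1 : ℝ≥0∞)) ω) ∂μ :=
        lintegral_mono hpt
    _ = k + (k + 1) * ∑' j, μ (P (N j))ᶜ := by
        have hm : ∀ j, Measurable ((P (N j))ᶜ.indicator fun _ => (1 : ℝ≥0∞)) :=
          fun j => measurable_const.indicator (hmeas _).compl
        rw [lintegral_add_left measurable_const, lintegral_const, measure_univ, mul_one,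
          lintegral_const_mul _ (Measurable.tsum hm), lintegral_tsum fun j => (hm j).aemeasurable]
        congr 3
        ext j
        rw [lintegral_indicator_const (hmeas _).compl, one_mul]
    _ ≤ k + (k + 1) * ∑' j : ℕ, (1 - p) ^ j := by
        gcongr
        exact hgeom _
    _ = k + (k + 1) * p⁻¹ := by
        rw [ENNReal.tsum_geometric, ENNReal.sub_sub_cancel ENNReal.one_ne_top hp]

end Hitting


/-! ### Covering as hitting finitely many targets -/

section Targets

variable {V : Type*} {G : SimpleGraph V}

/-- What has to be visited to cover a ball: its edges, or its vertices `x` in the form `(x, x)`. -/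
def targets (G : SimpleGraph V) (q : Recording) (r : ℕ) (v : V) : Set (V × V) :=
  match q with
  | .anonymization => {e | e.1 ∈ ballSet G r v ∧ e.2 ∈ ballSet G r v ∧ G.Adj e.1 e.2}
  | .namedNeighbors => {e | e.1 ∈ ballSet G r v ∧ e.2 = e.1}

/-- The event that a target has been visited by time `n`. -/
def hits (q : Recording) (e : V × V) (n : ℕ) : Set (ℕ → State V) :=
  match q with
  | .anonymization =>
    {ω | ∃ t < n, (ω (t + 1)).restarted = false ∧ s((ω t).pos, (ω (t + 1)).pos) = s(e.1, e.2)}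
  | .namedNeighbors => {ω | ∃ t ≤ n, (ω t).pos = e.1}

lemma covered_iff {q : Recording} {r n : ℕ} {v : V} {ω : ℕ → State V} :
    Covered G q r v n ω ↔ ∀ e ∈ targets G q r v, ω ∈ hits q e n := by
  cases q with
  | anonymization =>
    exact ⟨fun h e he => h e.1 he.1 e.2 he.2.1 he.2.2,
      fun h x hx y hy hxy => h (x, y) ⟨hx, hy, hxy⟩⟩
  | namedNeighbors => exact ⟨fun h e he => h e.1 he.1, fun h x hx => h (x, x) ⟨hx, rfl⟩⟩

lemma monotone_hits (q : Recording) (e : V × V) : Monotone (hits q e) := by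
  intro m n hmn ω hω
  cases q with
  | anonymization =>
    obtain ⟨t, ht, h⟩ := hω
    exact ⟨t, ht.trans_le hmn, h⟩
  | namedNeighbors =>
    obtain ⟨t, ht, h⟩ := hω
    exact ⟨t, ht.trans hmn, h⟩

lemma isPast_hits (q : Recording) (e : V × V) (n : ℕ) : IsPast n (hits q e n) := by
  intro ω ω' h hω
  cases q with
  | anonymization =>
    obtain ⟨t, ht, h'⟩ := hω
    refine ⟨t, ht, ?_⟩
    rwa [← h t ht.le, ← h (t + 1) ht]
  | namedNeighbors =>
    obtain ⟨t, ht, h'⟩ := hω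
    refine ⟨t, ht, ?_⟩
    rwa [← h t ht]

lemma isPast_covered (G : SimpleGraph V) (q : Recording) (r : ℕ) (v : V) (n : ℕ) :
    IsPast n {ω | Covered G q r v n ω} := by
  intro ω ω' h hω
  exact covered_iff.2 fun e he => isPast_hits q e n ω ω' h (covered_iff.1 hω e he)

lemma coverTime_eq [Countable V] (q : Recording) (A : WalkAlgorithm G) (ρ : RestartRule) (r : ℕ)
    (v : V) : coverTime q A ρ r v =
      ∫⁻ ω, hitTime (fun n => {ω | Covered G q r v n ω}) ω ∂(walkLaw A ρ v) := by
  cases q <;> rfl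

lemma coverTime_le_sum [Countable V] {q : Recording} {A : WalkAlgorithm G} {ρ : RestartRule}
    {r : ℕ} {v : V}
    {F : Finset (V × V)} (hF : ∀ e, e ∈ F ↔ e ∈ targets G q r v) :
    coverTime q A ρ r v ≤ ∑ e ∈ F, ∫⁻ ω, hitTime (hits q e) ω ∂(walkLaw A ρ v) := by
  rw [coverTime_eq, ← lintegral_finsetSum _ fun e _ =>
    measurable_hitTime fun n => (isPast_hits q e n).measurableSet]
  refine lintegral_mono fun ω => ?_
  simp only [covered_iff, ← hF]
  exact hitTime_forall_le_sum F (hits q) (monotone_hits q) ω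

/-- Number of steps along edges that suffice to reach a target from the centre. -/
def reach (r : ℕ) : Recording → ℕ
  | .anonymization => r + 1
  | .namedNeighbors => r

/-- The states of a walk which restarts and then follows the path `w`. -/
def script (w : ℕ → V) : ℕ → State V
  | 0 => ⟨w 0, true⟩
  | i + 1 => ⟨w (i + 1), false⟩

@[simp]
lemma script_pos (w : ℕ → V) (i : ℕ) : (script w i).pos = w i := by
  cases i <;> rfl

/-- A vertex is reached along a path of at most `r` edges; an edge needs one more step after
reaching its first endpoint. This is why the two recordings require different periods. -/
lemma exists_path_hits {q : Recording} {r : ℕ} {v : V} {e : V × V} (he : e ∈ targets G q r v) :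
    ∃ (w : ℕ → V) (m : ℕ), m ≤ reach r q ∧ w 0 = v ∧ (∀ i < m, G.Adj (w i) (w (i + 1))) ∧
      ∀ (n : ℕ) (ω : ℕ → State V), (∀ j < m + 1, ω (n + 1 + j) = script w j) →
        ω ∈ hits q e (n + 1 + m) := by
  cases q with
  | namedNeighbors =>
    obtain ⟨p, hp⟩ := mem_ballSet_iff.1 he.1
    refine ⟨p.getVert, p.length, hp, p.getVert_zero, fun i hi => p.adj_getVert_succ hi,
      fun n ω h => ⟨_, le_rfl, ?_⟩⟩
    rw [h _ (Nat.lt_succ_self _), script_pos, p.getVert_length]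
  | anonymization =>
    obtain ⟨p, hp⟩ := mem_ballSet_iff.1 he.1
    let p' := p.concat he.2.2
    have hlen : p'.length = p.length + 1 := SimpleGraph.Walk.length_concat _ _
    refine ⟨p'.getVert, p'.length, by rw [hlen]; exact Nat.succ_le_succ hp, p'.getVert_zero,
      fun i hi => p'.adj_getVert_succ hi, fun n ω h => ⟨n + 1 + p.length, by omega, ?_⟩⟩
    have h1 := h p.length (by omega)
    have h2 := h (p.length + 1) (by omega)
    have e1 : p'.getVert p.length = e.1 := by
      simp [p', SimpleGraph.Walk.concat_eq_append, SimpleGraph.Walk.getVert_append]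
    have e2 : p'.getVert (p.length + 1) = e.2 := by
      rw [← hlen, p'.getVert_length]
    refine ⟨?_, ?_⟩
    · rw [add_assoc, h2]
      rfl
    · rw [h1, add_assoc, h2, script_pos, script_pos, e1, e2]

/-- Increasing the radius by one replaces each vertex by its closed neighbourhood, a factor of at
most `Δ + 1`. -/
lemma exists_finset_ballSet [G.LocallyFinite] (r : ℕ) (v : V) :
    ∃ s : Finset V, ballSet G r v ⊆ s ∧
      ∀ Δ : ℕ, (∀ u, G.degree u ≤ Δ) → s.card ≤ (Δ + 1) ^ r := by
  classical
  induction r with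
  | zero =>
    exact ⟨{v}, fun x hx => by simp [mem_ballSet_zero.1 hx], by simp⟩
  | succ r ih =>
    obtain ⟨s, hs, hcard⟩ := ih
    refine ⟨s.biUnion fun u => insert u (G.neighborFinset u), ?_, ?_⟩
    · intro x hx
      rw [Finset.mem_coe, Finset.mem_biUnion]
      rcases mem_ballSet_succ.1 hx with rfl | ⟨y, hy, h⟩
      · exact ⟨x, hs (mem_ballSet_self _ _), by simp⟩
      · exact ⟨y, hs hy, by simp [h]⟩
    · intro Δ hΔ
      refine (Finset.card_biUnion_le_card_mul _ _ (Δ + 1) fun u _ => ?_).trans ?_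
      · exact (Finset.card_insert_le _ _).trans (Nat.succ_le_succ (hΔ u))
      · rw [pow_succ]
        exact Nat.mul_le_mul_right _ (hcard Δ hΔ)

lemma exists_finset_targets [G.LocallyFinite] (q : Recording) (r : ℕ) (v : V) :
    ∃ F : Finset (V × V), (∀ e, e ∈ F ↔ e ∈ targets G q r v) ∧
      ∀ Δ : ℕ, (∀ u, G.degree u ≤ Δ) → F.card ≤ (Δ + 1) ^ r * (Δ + 1) ^ r := by
  classical
  obtain ⟨s, hs, hcard⟩ := exists_finset_ballSet (G := G) r v
  refine ⟨(s ×ˢ s).filter (· ∈ targets G q r v), fun e => ?_, fun Δ hΔ => ?_⟩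
  · rw [Finset.mem_filter, and_iff_right_iff_imp, Finset.mem_product]
    intro he
    cases q with
    | anonymization => exact ⟨hs he.1, hs he.2.1⟩
    | namedNeighbors => exact ⟨hs he.1, he.2 ▸ hs he.1⟩
  · refine (Finset.card_filter_le _ _).trans ?_
    rw [Finset.card_product]
    exact Nat.mul_le_mul (hcard Δ hΔ) (hcard Δ hΔ)

/-- Admissible restart rules admit restarts at all multiples of `k + 1`, and `k` steps along edges
in between. -/
lemma RestartRule.Admissible.exists_coin_bound {q : Recording} {r : ℕ} {ρ : RestartRule}
    (h : ρ.Admissible q r) : ∃ k, reach r q ≤ k ∧ ∃ β : ℝ≥0∞, β ≠ 0 ∧ β ≤ 1 ∧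
      (∀ t, (k + 1) ∣ t → β ≤ ρ.coin t true) ∧ ∀ t, ¬ (k + 1) ∣ t → β ≤ ρ.coin t false := by
  cases ρ with
  | random α hα =>
    have h1 : (α : ℝ≥0∞) ≠ 0 := by exact_mod_cast hα.1.ne'
    have h2 : (1 : ℝ≥0∞) - α ≠ 0 := (tsub_pos_of_lt (by exact_mod_cast hα.2)).ne'
    -- Random restarts have no preferred times, so the shortest sufficient block length is taken.
    refine ⟨reach r q, le_rfl, min α (1 - α), ?_, (min_le_right _ _).trans tsub_le_self,
      fun t _ => ?_, fun t _ => ?_⟩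
    · rcases min_choice (α : ℝ≥0∞) (1 - α) with h | h <;> rw [h] <;> assumption
    · exact (min_le_left _ _).trans (by simp [RestartRule.coin])
    · exact (min_le_right _ _).trans (by simp [RestartRule.coin])
  | periodic k =>
    refine ⟨k, ?_, 1, one_ne_zero, le_rfl, fun t ht => ?_, fun t ht => ?_⟩
    · cases q <;> exact h
    · simp [RestartRule.coin, ht]
    · simp [RestartRule.coin, ht]

end Targets

/-! ### First-order walks -/

section FirstOrder

variable {V : Type*} {G : SimpleGraph V}

open Classical in
/-- Probability that the first-order walk moves from `u` to `x`. -/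
noncomputable def transProb (G : SimpleGraph V) (c : Sym2 V → ℝ≥0) (u x : V) : ℝ≥0∞ :=
  (if G.Adj u x then (c s(u, x) : ℝ≥0∞) else 0) *
    (∑' y, if G.Adj u y then (c s(u, y) : ℝ≥0∞) else 0)⁻¹

variable [G.LocallyFinite]

lemma firstOrder_next (hG : ∀ u, ∃ x, G.Adj u x) (c : Sym2 V → ℝ≥0)
    (hc : ∀ e ∈ G.edgeSet, 0 < c e) (n : ℕ) (h : Finset.Iic n → State V) (x : V) :
    (firstOrder G hG c hc).next n h x = transProb G c (h ⟨n, Finset.mem_Iic.2 le_rfl⟩).pos x := by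
  rfl

lemma tsum_conductance (c : Sym2 V → ℝ≥0) (u : V) :
    (∑' y, open Classical in if G.Adj u y then (c s(u, y) : ℝ≥0∞) else 0) =
      ∑ y ∈ G.neighborFinset u, (c s(u, y) : ℝ≥0∞) := by
  rw [tsum_eq_sum (s := G.neighborFinset u) fun y hy => by
    rw [if_neg (by simpa using hy)]]
  exact Finset.sum_congr rfl fun y hy => if_pos (by simpa using hy)

lemma transProb_ne_zero {c : Sym2 V → ℝ≥0} (hc : ∀ e ∈ G.edgeSet, 0 < c e) {u x : V}
    (h : G.Adj u x) : transProb G c u x ≠ 0 := by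
  rw [transProb, tsum_conductance, if_pos h]
  refine mul_ne_zero ?_ (ENNReal.inv_ne_zero.2 (ENNReal.sum_ne_top.2 fun _ _ => ENNReal.coe_ne_top))
  exact_mod_cast (hc s(u, x) h).ne'

/-- The chosen edge has weight at least `a`, and the at most `Δ` edges at `u` have total weight at
most `Δ * b`. -/
lemma le_transProb {c : Sym2 V → ℝ≥0} {a b : ℝ≥0} {Δ : ℕ} (hΔ : ∀ u, G.degree u ≤ Δ)
    (hab : ∀ e ∈ G.edgeSet, a ≤ c e ∧ c e ≤ b) {u x : V} (h : G.Adj u x) :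
    (a : ℝ≥0∞) * (Δ * b : ℝ≥0∞)⁻¹ ≤ transProb G c u x := by
  rw [transProb, tsum_conductance, if_pos h]
  gcongr
  · exact (hab s(u, x) h).1
  · calc ∑ y ∈ G.neighborFinset u, (c s(u, y) : ℝ≥0∞) ≤ ∑ _y ∈ G.neighborFinset u, (b : ℝ≥0∞) :=
          Finset.sum_le_sum fun y hy =>
            ENNReal.coe_le_coe.2 (hab s(u, y) ((G.mem_neighborFinset u y).1 hy)).2
      _ ≤ Δ * b := by
          rw [Finset.sum_const, nsmul_eq_mul, G.card_neighborFinset_eq_degree]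
          gcongr
          exact hΔ u

variable [Countable V] {hG : ∀ u, ∃ x, G.Adj u x} {c : Sym2 V → ℝ≥0}
  {hc : ∀ e ∈ G.edgeSet, 0 < c e} {ρ : RestartRule}

/-- Bound for the expected time to hit a target that is the end of a path from the centre. -/
lemma lintegral_hitTime_hits_le {q : Recording} {v : V} {e : V × V} {k : ℕ} {β κ : ℝ≥0∞}
    (hβ : β ≤ 1) (hβ1 : ∀ t, (k + 1) ∣ t → β ≤ ρ.coin t true)
    (hβ0 : ∀ t, ¬ (k + 1) ∣ t → β ≤ ρ.coin t false) (hκ1 : κ ≤ 1) {w : ℕ → V} {m : ℕ} (hm : m ≤ k)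
    (hw : w 0 = v) (hκ : ∀ i < m, κ ≤ transProb G c (w i) (w (i + 1)))
    (hhit : ∀ (n : ℕ) (ω : ℕ → State V), (∀ j < m + 1, ω (n + 1 + j) = script w j) →
        ω ∈ hits q e (n + 1 + m)) :
    ∫⁻ ω, hitTime (hits q e) ω ∂(walkLaw (firstOrder G hG c hc) ρ v) ≤
      k + (k + 1) * ((β * κ) ^ (k + 1))⁻¹ := by
  have hβκ : β * κ ≤ 1 := mul_le_one' hβ hκ1
  refine lintegral_hitTime_le (fun n => (isPast_hits q e n).measurableSet) k
    (pow_le_one' hβκ _) (fun j => ?_) (monotone_hits q e)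
  set N := (k + 1) * j + k with hN
  -- Step `i` of the script is transition number `N + i + 1`. Within the block only `i = 0` falls on
  -- a multiple of `k + 1`, so the forced restart never interrupts the path.
  have hdvd : ∀ i ≤ k, ((k + 1) ∣ N + i + 1 ↔ i = 0) := by
    intro i hi
    have : N + i + 1 = (k + 1) * (j + 1) + i := by rw [hN]; ring
    rw [this, Nat.dvd_add_right (dvd_mul_right _ _)]
    exact ⟨fun h => Nat.eq_zero_of_dvd_of_lt h (by omega), fun h => h ▸ dvd_zero _⟩
  calc (β * κ) ^ (k + 1) * walkLaw (firstOrder G hG c hc) ρ v (hits q e N)ᶜ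
      ≤ (β * κ) ^ (m + 1) * walkLaw (firstOrder G hG c hc) ρ v (hits q e N)ᶜ := by
        -- The exponent is raised from `m + 1` to `k + 1` to obtain a bound independent of the path
        -- length.
        gcongr 1
        exact pow_le_pow_right_of_le_one' hβκ (by omega)
    _ ≤ walkLaw (firstOrder G hG c hc) ρ v
        ((hits q e N)ᶜ ∩ {ω | ∀ i < m + 1, ω (N + 1 + i) = script w i}) := by
        refine pow_mul_le_walkLaw_inter (isPast_hits q e N).compl _ _ fun i hi ω h0 hω => ?_
        cases i with
        | zero =>
          have h := coin_le_stepLaw_restart (firstOrder G hG c hc) ρ (N + 0)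
            (Preorder.frestrictLe (N + 0) ω)
          rw [Preorder.frestrictLe_apply] at h
          have hs : script w 0 = ⟨(ω 0).pos, true⟩ := by rw [h0, ← hw]; rfl
          rw [hs]
          refine le_trans ?_ h
          exact (mul_le_of_le_one_right' hκ1).trans (hβ1 _ ((hdvd 0 (Nat.zero_le k)).2 rfl))
        | succ i =>
          refine le_trans ?_ (coin_mul_next_le_stepLaw (firstOrder G hG c hc) ρ (N + (i + 1))
            (Preorder.frestrictLe (N + (i + 1)) ω) (w (i + 1)))
          rw [firstOrder_next, Preorder.frestrictLe_apply]
          have hpos : (ω (N + (i + 1))).pos = w i := by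
            rw [← script_pos w i, ← hω i (Nat.lt_succ_self i)]
            congr 2
            omega
          simp only [hpos]
          exact mul_le_mul' (hβ0 _ fun h => by
            have := (hdvd (i + 1) (by omega)).1 h
            omega) (hκ i (by omega))
    _ ≤ _ := by
        refine measure_mono (Set.inter_subset_inter_right _ fun ω hω => ?_)
        -- Since `m ≤ k`, the script ends no later than the next checkpoint `N + 1 + k`.
        exact monotone_hits q e (by rw [hN, mul_add]; omega) (hhit N ω hω)

lemma blockBound_ne_top {k : ℕ} {p : ℝ≥0∞} (hp : p ≠ 0) :
    (k : ℝ≥0∞) + (k + 1) * (p ^ (k + 1))⁻¹ ≠ ⊤ :=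
  ENNReal.add_ne_top.2 ⟨ENNReal.natCast_ne_top k, ENNReal.mul_ne_top (by finiteness)
    (ENNReal.inv_ne_top.2 (pow_ne_zero _ hp))⟩

theorem coverTime_firstOrder_lt_top {q : Recording} {r : ℕ} (hρ : ρ.Admissible q r) (v : V) :
    coverTime q (firstOrder G hG c hc) ρ r v < ⊤ := by
  obtain ⟨k, hk, β, hβ, hβ', hβ1, hβ0⟩ := hρ.exists_coin_bound
  obtain ⟨F, hF, -⟩ := exists_finset_targets (G := G) q r v
  refine (coverTime_le_sum hF).trans_lt (ENNReal.sum_lt_top.2 fun e he => ?_)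
  obtain ⟨w, m, hm, hw, hadj, hhit⟩ := exists_path_hits ((hF e).1 he)
  -- The least transition probability along the finite path, positive because the conductances are;
  -- it may depend on the target and on `v`.
  set κ : ℝ≥0∞ := min 1 ((Finset.range m).inf fun i => transProb G c (w i) (w (i + 1))) with hκ
  have hκ0 : κ ≠ 0 := by
    refine (lt_min one_pos ((Finset.lt_inf_iff ENNReal.zero_lt_top).2 fun i hi => ?_)).ne'
    exact pos_iff_ne_zero.2 (transProb_ne_zero hc (hadj i (Finset.mem_range.1 hi)))
  refine (lintegral_hitTime_hits_le (κ := κ) hβ' hβ1 hβ0 (min_le_left _ _) (hm.trans hk) hw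
    (fun i hi => (min_le_right _ _).trans (Finset.inf_le (Finset.mem_range.2 hi)))
    hhit).trans_lt ?_
  exact lt_top_iff_ne_top.2 (blockBound_ne_top (mul_ne_zero hβ hκ0))

theorem exists_coverTime_firstOrder_le {q : Recording} {r : ℕ} (hρ : ρ.Admissible q r) {Δ : ℕ}
    (hΔ : ∀ u, G.degree u ≤ Δ) {a b : ℝ≥0} (ha : 0 < a)
    (hab : ∀ e ∈ G.edgeSet, a ≤ c e ∧ c e ≤ b) :
    ∃ C : ℝ≥0, ∀ v, coverTime q (firstOrder G hG c hc) ρ r v ≤ C := by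
  obtain ⟨k, hk, β, hβ, hβ', hβ1, hβ0⟩ := hρ.exists_coin_bound
  -- Here the lower bound is the same for all edges, hence for all targets and all `v`.
  set κ : ℝ≥0∞ := min 1 (a * (Δ * b : ℝ≥0∞)⁻¹) with hκ
  have hκ0 : κ ≠ 0 := by
    refine (lt_min one_pos (pos_iff_ne_zero.2 (mul_ne_zero (by exact_mod_cast ha.ne') ?_))).ne'
    exact ENNReal.inv_ne_zero.2 (by finiteness)
  set M : ℝ≥0∞ := k + (k + 1) * ((β * κ) ^ (k + 1))⁻¹ with hM
  have hfin : (((Δ + 1) ^ r * (Δ + 1) ^ r : ℕ) : ℝ≥0∞) * M ≠ ⊤ :=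
    ENNReal.mul_ne_top (ENNReal.natCast_ne_top _) (blockBound_ne_top (mul_ne_zero hβ hκ0))
  refine ⟨((((Δ + 1) ^ r * (Δ + 1) ^ r : ℕ) : ℝ≥0∞) * M).toNNReal, fun v => ?_⟩
  rw [ENNReal.coe_toNNReal hfin]
  obtain ⟨F, hF, hcard⟩ := exists_finset_targets (G := G) q r v
  refine (coverTime_le_sum hF).trans ((Finset.sum_le_card_nsmul F _ M fun e he => ?_).trans ?_)
  · obtain ⟨w, m, hm, hw, hadj, hhit⟩ := exists_path_hits ((hF e).1 he)
    exact lintegral_hitTime_hits_le hβ' hβ1 hβ0 (min_le_left _ _) (hm.trans hk) hw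
      (fun i hi => (min_le_right _ _).trans (le_transProb hΔ hab (hadj i hi))) hhit
  · rw [nsmul_eq_mul]
    gcongr
    exact hcard Δ hΔ

end FirstOrder

/-! ### Approximation -/

section Approximation

variable {V : Type*} [Countable V] {G : SimpleGraph V}

/-- Probability that the ball around the starting point is covered by time `l`. -/
lemma lt_walkLaw_covered {q : Recording} {A : WalkAlgorithm G} {ρ : RestartRule} {r l : ℕ} {v : V}
    {δ : ℝ} (hδ : 0 < δ) (hl : coverTime q A ρ r v / ENNReal.ofReal δ < l) :
    1 - δ < (walkLaw A ρ v).real {ω | Covered G q r v l ω} := by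
  have hδ' : ENNReal.ofReal δ ≠ 0 := (ENNReal.ofReal_pos.2 hδ).ne'
  have hl0 : (l : ℝ≥0∞) ≠ 0 := (pos_of_gt hl).ne'
  have hmeas : MeasurableSet {ω | Covered G q r v l ω} := (isPast_covered G q r v l).measurableSet
  -- Coverage persists, so failure at time `l` means a cover time of at least `l`, and Markov's
  -- inequality applies.
  have hsub : {ω | Covered G q r v l ω}ᶜ ⊆
      {ω | (l : ℝ≥0∞) ≤ hitTime (fun n => {ω | Covered G q r v n ω}) ω} := by
    intro ω hω
    rw [Set.mem_ofPred_eq]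
    refine le_of_not_gt fun h => hω ?_
    obtain ⟨n, hn, hn'⟩ := exists_of_hitTime_lt h
    exact Covered.mono (by exact_mod_cast hn.le) hn'
  have hlt : walkLaw A ρ v {ω | Covered G q r v l ω}ᶜ < ENNReal.ofReal δ := by
    refine (measure_mono hsub).trans_lt ((meas_ge_le_lintegral_div (measurable_hitTime fun n =>
      (isPast_covered G q r v n).measurableSet).aemeasurable hl0
      (ENNReal.natCast_ne_top l)).trans_lt ?_)
    rw [← coverTime_eq]
    refine ENNReal.div_lt_of_lt_mul' ?_
    rwa [ENNReal.div_lt_iff (Or.inl hδ') (Or.inl ENNReal.ofReal_ne_top)] at hl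
  have hreal : (walkLaw A ρ v).real {ω | Covered G q r v l ω}ᶜ < δ :=
    (ENNReal.lt_ofReal_iff_toReal_lt (measure_ne_top _ _)).1 hlt
  rw [probReal_compl_eq_one_sub hmeas] at hreal
  linarith

theorem exists_lt_probNear {q : Recording} {ρ : RestartRule} {r l : ℕ} {Θ : Type*}
    {f : Θ → Record → ℝ} (hf : UniversalReader f (recordRange G q l)) (A : WalkAlgorithm G)
    {φ : V → ℝ} (hφ : InvariantOnBalls G r φ) {ε δ : ℝ} (hε : 0 < ε) (hδ : 0 < δ) :
    ∃ θ : Θ, ∀ v : V, coverTime q A ρ r v / ENNReal.ofReal δ < l →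
      1 - δ < probNear A ρ q l f θ v (φ v) ε := by
  classical
  let E : Record → (ℕ → State V) → Prop := fun z ω =>
    IsWalk G l ω ∧ Covered G q r (ω 0).pos l ω ∧ record G q l ω = z
  -- The target function sends a record to `φ` at the start of some covering walk producing it, and
  -- to the irrelevant value 0 if there is none. It does not involve `v`, so `θ` is fixed before
  -- `v`.
  obtain ⟨θ, hθ⟩ := hf (fun z => if h : ∃ ω, E z ω then φ (h.choose 0).pos else 0) ε hε
  refine ⟨θ, fun v hv => (lt_walkLaw_covered hδ hv).trans_le ?_⟩
  refine ENNReal.toReal_mono (measure_ne_top _ _) (measure_mono_ae ?_)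
  filter_upwards [walkLaw_ae_isWalk A ρ v l] with ω hω hc
  obtain ⟨rfl, hω⟩ := hω
  have hex : ∃ ω', E (record G q l ω) ω' := ⟨ω, hω, hc, rfl⟩
  have hz := hθ (record G q l ω) ⟨ω, hω, rfl⟩
  obtain ⟨hω', hc', hrec⟩ := hex.choose_spec
  -- The chosen walk may start at another vertex, but its ball is isomorphic to that of `ω`, so
  -- invariance identifies the two values of `φ`.
  rw [dif_pos hex, hφ _ _ (ballIso_of_record_eq hω' hω hc' hc hrec)] at hz
  exact hz

end Approximation

end RWNN

theorem mainTheorem4 {V : Type*} [Countable V] (G : SimpleGraph V) [G.LocallyFinite]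
    (hG : ∀ u, ∃ x, G.Adj u x) (r : ℕ) (hr : 1 ≤ r)
    (q : RWNN.Recording) (ρ : RWNN.RestartRule) (hρ : ρ.Admissible q r)
    {Θ : Type*} (f : Θ → RWNN.Record → ℝ)
    (hf : ∀ l, RWNN.UniversalReader f (RWNN.recordRange G q l)) :
    -- approximation for all long enough walks, whatever the walk algorithm
    (∀ A : RWNN.WalkAlgorithm G, ∀ φ : V → ℝ, RWNN.InvariantOnBalls G r φ →
      ∀ ε δ : ℝ, 0 < ε → 0 < δ → ∀ l : ℕ, ∃ θ : Θ, ∀ v : V,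
        RWNN.coverTime q A ρ r v / ENNReal.ofReal δ < l →
          1 - δ < RWNN.probNear A ρ q l f θ v (φ v) ε) ∧
    -- for first-order walks such lengths exist, and the network is a universal approximator
    (∀ (c : Sym2 V → NNReal) (hc : ∀ e ∈ G.edgeSet, 0 < c e),
      (∀ v, RWNN.coverTime q (RWNN.firstOrder G hG c hc) ρ r v < ⊤) ∧
      ((∃ Δ : ℕ, ∀ v, G.degree v ≤ Δ) →
        (∃ a b : NNReal, 0 < a ∧ ∀ e ∈ G.edgeSet, a ≤ c e ∧ c e ≤ b) →
          (∃ C : NNReal, ∀ v, RWNN.coverTime q (RWNN.firstOrder G hG c hc) ρ r v ≤ C) ∧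
          RWNN.UniversalApproximator (RWNN.firstOrder G hG c hc) ρ q f r)) := by
  refine ⟨fun A φ hφ ε δ hε hδ l => RWNN.exists_lt_probNear (hf l) A hφ hε hδ,
    fun c hc => ⟨RWNN.coverTime_firstOrder_lt_top hρ, ?_⟩⟩
  rintro ⟨Δ, hΔ⟩ ⟨a, b, ha, hab⟩
  obtain ⟨C, hC⟩ := RWNN.exists_coverTime_firstOrder_le (hG := hG) (hc := hc) hρ hΔ ha hab
  refine ⟨⟨C, hC⟩, fun φ hφ ε δ hε hδ => ?_⟩
  have hδ' : ENNReal.ofReal δ ≠ 0 := (ENNReal.ofReal_pos.2 hδ).ne'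
  -- The uniform bound `C` allows one length for all start vertices.
  obtain ⟨l, hl⟩ := ENNReal.exists_nat_gt (ENNReal.div_ne_top (ENNReal.coe_ne_top (r := C)) hδ')
  obtain ⟨θ, hθ⟩ := RWNN.exists_lt_probNear (ρ := ρ) (hf l) (RWNN.firstOrder G hG c hc) hφ hε hδ
  exact ⟨l, θ, fun v => hθ v ((ENNReal.div_le_div_right (hC v) _).trans_lt hl)⟩
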